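/- Let $X \subset \mathbb{P}^3$ be a smooth quartic surface over $\mathbb{C}$. Two disjoint lines $l', l''$ on $X$ are called twin lines if there exist $10$ other distinct lines on $X$, each of which intersects both $l'$ and $l''$. For a plane $\Pi$ containing a line $l'$ on $X$, the residual cubic of $l'$ in $\Pi$ is the plane cubic curve $C$ such that $X \cap \Pi = l' + C$ as divisors on $\Pi$. Suppose that $l', l''$ are twin lines on $X$ and that the residual cubic of $l'$ in a plane $\Pi$ containing $l'$ splits into three lines $m_1, m_2, m_3$ (counted with multiplicity, not assumed distinct). If $m_1$ intersects $l''$, then $m_2$ and $m_3$ meet in exactly one point, and this point lies on $l'$. -/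

import Mathlib

open scoped LinearAlgebra.Projectivization

/-- The four-dimensional space `ℂ⁴`. Points, lines and planes of the projective space `ℙ³` over `ℂ`
are its linear subspaces of dimension one, two and three. -/
abbrev C4 : Type := Fin 4 → ℂ

/-- `l` is a line of `ℙ³`. -/
def IsProjLine (l : Submodule ℂ C4) : Prop := Module.finrank ℂ l = 2

/-- `E` is a plane of `ℙ³`. -/
def IsProjPlane (E : Submodule ℂ C4) : Prop := Module.finrank ℂ E = 3

/-- Two linear subvarieties of `ℙ³` intersect: they have a common point. -/
def Meets (l m : Submodule ℂ C4) : Prop :=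
  ∃ P : ℙ ℂ C4, P.submodule ≤ l ∧ P.submodule ≤ m

/-- `F` is the equation of a smooth quartic surface `X ⊂ ℙ³`: it is homogeneous of degree four and
its gradient vanishes at no point of `X`. -/
def IsSmoothQuartic (F : MvPolynomial (Fin 4) ℂ) : Prop :=
  F.IsHomogeneous 4 ∧
    ∀ v : C4, v ≠ 0 → MvPolynomial.eval v F = 0 →
      ∃ i, MvPolynomial.eval v (MvPolynomial.pderiv i F) ≠ 0

/-- `l` is a line of `ℙ³` contained in the surface `F = 0`. -/
def IsLineOn (F : MvPolynomial (Fin 4) ℂ) (l : Submodule ℂ C4) : Prop :=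
  IsProjLine l ∧ ∀ v ∈ l, MvPolynomial.eval v F = 0

/-- `l` and `l'` are twin lines on the surface `F = 0`: disjoint lines on it such that there are ten
other distinct lines on it, each of which intersects both. -/
def AreTwinLines (F : MvPolynomial (Fin 4) ℂ) (l l' : Submodule ℂ C4) : Prop :=
  IsLineOn F l ∧ IsLineOn F l' ∧ ¬ Meets l l' ∧
    ∃ S : Finset (Submodule ℂ C4), S.card = 10 ∧
      ∀ m ∈ S, IsLineOn F m ∧ m ≠ l ∧ m ≠ l' ∧ Meets m l ∧ Meets m l'

/-- The linear form `φ` is an equation of the line `m` inside the plane `E`. (When `E` is a plane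
and `m` is a line, `φ` does not vanish identically on `E`.) -/
def IsEquationIn (E m : Submodule ℂ C4) (φ : Module.Dual ℂ C4) : Prop :=
  E ⊓ LinearMap.ker φ = m

/-- The cubic form `G` defines, in the plane `E` containing the line `l`, the residual cubic of `l`:
on `E` the form `F` is the product of an equation of `l` and of `G`, that is, the divisor cut out
on `E` by `F = 0` is the sum of `l` and of the cubic curve `G = 0`. -/
def IsResidualCubic (F : MvPolynomial (Fin 4) ℂ) (l E : Submodule ℂ C4)
    (G : MvPolynomial (Fin 4) ℂ) : Prop :=
  G.IsHomogeneous 3 ∧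
    ∃ φ : Module.Dual ℂ C4, IsEquationIn E l φ ∧
      ∀ v ∈ E, MvPolynomial.eval v F = φ v * MvPolynomial.eval v G

/-- The cubic curve `G = 0` in the plane `E` splits into the lines `m₁, m₂, m₃`
(with multiplicities): on `E` the form `G` is a product of equations of the three lines. -/
def SplitsIntoLines (E : Submodule ℂ C4) (G : MvPolynomial (Fin 4) ℂ)
    (m₁ m₂ m₃ : Submodule ℂ C4) : Prop :=
  IsProjLine m₁ ∧ IsProjLine m₂ ∧ IsProjLine m₃ ∧
    ∃ φ₁ φ₂ φ₃ : Module.Dual ℂ C4,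
      IsEquationIn E m₁ φ₁ ∧ IsEquationIn E m₂ φ₂ ∧ IsEquationIn E m₃ φ₃ ∧
      ∀ v ∈ E, MvPolynomial.eval v G = φ₁ v * φ₂ v * φ₃ v

/-! Write `ℂ⁴ = V ⊕ W` with `V = l''`, `W = l'`, and let `B` be the polarization of `F`. Since both
lines lie on the surface, only the parts `B x y y y`, `B x x y y`, `B x x x y` of `F (x + y)`
survive (`x ∈ V`, `y ∈ W`).

Ten transversals kill the middle part (`IsSkewLinePair.apply_eq_zero_of_transversals`). A
transversal through `y` meets `V` at the unique zero of `x ↦ B x y y y`, a point of degree 3 in `y`.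
Substituting it into `B x x y y` gives a form of degree 8 in `y` with too many zeros, and
coprimality then forces the whole `(2, 2)` part to vanish.

Let `p` be the point where `m₁` meets `l''`. On the points `s • p + y` of `E` the residual cubic is
now even in `s`. As `φ₁ p = 0`, the product `φ₂ φ₃` is even too (`residual_identities`), so `φ₂` and
`φ₃` are proportional on `l'` with opposite ratios at `p`. Smoothness excludes the degenerate cases,
and the two lines meet only at their common point on `l'`. -/

/-- Quadrilinear forms on `ℂ⁴`. -/
abbrev QuadrilinearForm : Type := C4 →ₗ[ℂ] C4 →ₗ[ℂ] C4 →ₗ[ℂ] C4 →ₗ[ℂ] ℂ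

/-! ### Symmetric quadrilinear forms -/

namespace QuadrilinearForm

/-- Symmetry of a quadrilinear form, tested on adjacent transpositions. -/
structure IsSymm (B : QuadrilinearForm) : Prop where
  swap_first : ∀ a b c d, B a b c d = B b a c d
  swap_middle : ∀ a b c d, B a b c d = B a c b d
  swap_last : ∀ a b c d, B a b c d = B a b d c

variable {B : QuadrilinearForm}

theorem IsSymm.apply_add_smul (hB : B.IsSymm) (x y : C4) (a b : ℂ) :
    B (a • x + b • y) (a • x + b • y) (a • x + b • y) (a • x + b • y) =
      a ^ 4 * B x x x x + 4 * a ^ 3 * b * B x x x y + 6 * a ^ 2 * b ^ 2 * B x x y y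
        + 4 * a * b ^ 3 * B x y y y + b ^ 4 * B y y y y := by
  simp only [map_add, map_smul, LinearMap.add_apply, LinearMap.smul_apply, smul_eq_mul]
  simp only [hB.swap_first y x, hB.swap_middle _ y x, hB.swap_last _ _ y x]
  ring

theorem IsSymm.reverse (hB : B.IsSymm) (x y : C4) : B x x x y = B y x x x := by
  rw [hB.swap_last, hB.swap_middle, hB.swap_first]

/-- A quartic form vanishing on a line through `x` and `y` has vanishing mixed values. -/
theorem IsSymm.mixed_eq_zero (hB : B.IsSymm) {x y : C4}
    (h : ∀ a : ℂ, B (a • x + y) (a • x + y) (a • x + y) (a • x + y) = 0) (hx : B x x x x = 0) :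
    B x x x y = 0 ∧ B x x y y = 0 ∧ B x y y y = 0 := by
  have key (a : ℂ) : a ^ 4 * B x x x x + 4 * a ^ 3 * 1 * B x x x y + 6 * a ^ 2 * 1 ^ 2 * B x x y y
      + 4 * a * 1 ^ 3 * B x y y y + 1 ^ 4 * B y y y y = 0 := by
    rw [← hB.apply_add_smul, one_smul, h]
  -- Once the coefficient of `a ^ 4` is gone, four values determine the polynomial.
  have h0 := key 0
  have h1 := key 1
  have h2 := key (-1)
  have h3 := key 2
  rw [hx] at h0 h1 h2 h3
  refine ⟨?_, ?_, ?_⟩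
  · linear_combination (-1 / 8) * h1 - h2 / 24 + h3 / 24 + h0 / 8
  · linear_combination (h1 + h2 - 2 * h0) / 12
  · linear_combination h1 / 4 - h2 / 12 - h3 / 24 - h0 / 8

end QuadrilinearForm

/-! ### Polarization of a quartic form -/

namespace MvPolynomial

/-- The directional derivative, as a linear function of the direction. -/
noncomputable def dirDeriv : C4 →ₗ[ℂ] MvPolynomial (Fin 4) ℂ →ₗ[ℂ] MvPolynomial (Fin 4) ℂ :=
  ∑ i, (LinearMap.proj i : C4 →ₗ[ℂ] ℂ).smulRight (pderiv (R := ℂ) i).toLinearMap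

theorem dirDeriv_apply (v : C4) (p : MvPolynomial (Fin 4) ℂ) :
    dirDeriv v p = ∑ i, v i • pderiv i p := by
  simp [dirDeriv, LinearMap.sum_apply]

theorem pderiv_comm (i j : Fin 4) (p : MvPolynomial (Fin 4) ℂ) :
    pderiv i (pderiv j p) = pderiv j (pderiv i p) := by
  have h : ⁅(pderiv i : Derivation ℂ (MvPolynomial (Fin 4) ℂ) (MvPolynomial (Fin 4) ℂ)),
      pderiv (R := ℂ) j⁆ = 0 := by
    apply derivation_ext
    intro k
    simp [Derivation.commutator_apply, pderiv_X, Pi.single_apply, apply_ite]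
  have h2 := DFunLike.congr_fun h p
  rwa [Derivation.commutator_apply, Derivation.zero_apply, sub_eq_zero] at h2

theorem dirDeriv_comm (v w : C4) (p : MvPolynomial (Fin 4) ℂ) :
    dirDeriv v (dirDeriv w p) = dirDeriv w (dirDeriv v p) := by
  simp only [dirDeriv_apply, map_sum, map_smul, Finset.smul_sum]
  rw [Finset.sum_comm]
  refine Finset.sum_congr rfl fun i _ => Finset.sum_congr rfl fun j _ => ?_
  rw [pderiv_comm, smul_comm]

theorem IsHomogeneous.dirDeriv {p : MvPolynomial (Fin 4) ℂ} {n : ℕ} (hp : p.IsHomogeneous (n + 1))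
    (v : C4) : (dirDeriv v p).IsHomogeneous n := by
  rw [dirDeriv_apply]
  refine IsHomogeneous.sum _ _ _ fun i _ => ?_
  rw [smul_eq_C_mul]
  simpa using (isHomogeneous_C (Fin 4) (v i)).mul (hp.pderiv (i := i))

theorem IsHomogeneous.eval_dirDeriv {p : MvPolynomial (Fin 4) ℂ} {n : ℕ} (hp : p.IsHomogeneous n)
    (v : C4) : eval v (MvPolynomial.dirDeriv v p) = n * eval v p := by
  have h := congrArg (eval v) hp.sum_X_mul_pderiv
  simpa [dirDeriv_apply, smul_eval] using h

/-- The fourth polarization of a form. -/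
noncomputable def polarization (p : MvPolynomial (Fin 4) ℂ) : QuadrilinearForm :=
  let e : MvPolynomial (Fin 4) ℂ →ₗ[ℂ] ℂ := (aeval (0 : C4)).toLinearMap
  dirDeriv.flip.compr₂ (dirDeriv.flip.compr₂ (dirDeriv.flip.compr₂ (dirDeriv.flip.compr₂ e))) p

theorem polarization_apply (p : MvPolynomial (Fin 4) ℂ) (a b c d : C4) :
    polarization p a b c d =
      eval 0 (dirDeriv d (dirDeriv c (dirDeriv b (dirDeriv a p)))) := by
  rfl

theorem polarization_isSymm (p : MvPolynomial (Fin 4) ℂ) : (polarization p).IsSymm where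
  swap_first a b c d := by simp only [polarization_apply, dirDeriv_comm b a]
  swap_middle a b c d := by simp only [polarization_apply, dirDeriv_comm c b]
  swap_last a b c d := by simp only [polarization_apply, dirDeriv_comm d c]

theorem IsHomogeneous.eval_zero_eq {p : MvPolynomial (Fin 4) ℂ} (hp : p.IsHomogeneous 0) (v : C4) :
    eval 0 p = eval v p := by
  rw [← totalDegree_zero_iff_isHomogeneous, totalDegree_eq_zero_iff_eq_C] at hp
  rw [hp, eval_C, eval_C]

/-- Euler's identity in degrees 3, 2, 1 produces the factor 6. This turns smoothness into a
condition on `B`. -/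
theorem IsHomogeneous.polarization_dir {p : MvPolynomial (Fin 4) ℂ} (hp : p.IsHomogeneous 4)
    (v w : C4) : polarization p w v v v = 6 * eval v (MvPolynomial.dirDeriv w p) := by
  have h3 := hp.dirDeriv w
  have h2 := h3.dirDeriv v
  have h1 := h2.dirDeriv v
  have h0 := h1.dirDeriv v
  rw [polarization_apply, h0.eval_zero_eq v, h1.eval_dirDeriv, h2.eval_dirDeriv, h3.eval_dirDeriv]
  push_cast
  ring

theorem IsHomogeneous.polarization_self {p : MvPolynomial (Fin 4) ℂ} (hp : p.IsHomogeneous 4)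
    (v : C4) : polarization p v v v v = 24 * eval v p := by
  rw [hp.polarization_dir, hp.eval_dirDeriv]
  push_cast
  ring

end MvPolynomial

theorem IsSmoothQuartic.exists_polarization_ne_zero {F : MvPolynomial (Fin 4) ℂ}
    (hF : IsSmoothQuartic F) {v : C4} (hv : v ≠ 0)
    (h : MvPolynomial.polarization F v v v v = 0) :
    ∃ w, MvPolynomial.polarization F w v v v ≠ 0 := by
  rw [hF.1.polarization_self] at h
  obtain ⟨i, hi⟩ := hF.2 v hv (by simpa using h)
  refine ⟨Pi.single i 1, ?_⟩
  rw [hF.1.polarization_dir, MvPolynomial.dirDeriv_apply]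
  simpa [Pi.single_apply] using hi

/-! ### Linear algebra on a projective line -/

namespace Submodule

variable {K M : Type*} [Field K] [AddCommGroup M] [Module K M]

/-- Two linearly independent vectors span a two-dimensional subspace containing them. -/
theorem exists_eq_smul_add_smul_of_finrank_eq_two {W : Submodule K M}
    (hW : Module.finrank K W = 2) {u v : M} (hu : u ∈ W) (hv : v ∈ W)
    (huv : LinearIndependent K ![u, v]) {w : M} (hw : w ∈ W) :
    ∃ a b : K, w = a • u + b • v := by
  have : FiniteDimensional K W := Module.finite_of_finrank_eq_succ hW
  have hle : span K {u, v} ≤ W := span_le.mpr (by rintro z (rfl | rfl) <;> assumption)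
  have hfin : Module.finrank K (span K {u, v}) = 2 := by
    have h := finrank_span_eq_card huv
    rwa [Matrix.range_cons, Matrix.range_cons, Matrix.range_empty, Set.union_empty,
      Set.singleton_union, Fintype.card_fin] at h
  rw [← eq_of_le_of_finrank_eq hle (hfin.trans hW.symm), mem_span_pair] at hw
  obtain ⟨a, b, h⟩ := hw
  exact ⟨a, b, h.symm⟩

theorem exists_linearIndependent_of_finrank_eq_two {W : Submodule K M}
    (hW : Module.finrank K W = 2) {u : M} (hu : u ≠ 0) :
    ∃ v ∈ W, LinearIndependent K ![u, v] := by
  have : FiniteDimensional K W := Module.finite_of_finrank_eq_succ hW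
  by_contra! H
  have hle : W ≤ span K {u} := fun v hv => by
    by_contra hvu
    refine H v hv (LinearIndependent.pair_iff' hu |>.mpr fun a ha => hvu ?_)
    exact mem_span_singleton.mpr ⟨a, ha⟩
  have := finrank_mono hle
  rw [hW, finrank_span_singleton hu] at this
  omega

/-- The zeros, on a two-dimensional space, of a linear form not vanishing there are proportional. -/
theorem exists_eq_smul_of_apply_eq_zero {W : Submodule K M} (hW : Module.finrank K W = 2)
    (f : M →ₗ[K] K) {u x w : M} (hu : u ∈ W) (hfu : f u ≠ 0) (hx : x ∈ W) (hx0 : x ≠ 0)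
    (hfx : f x = 0) (hw : w ∈ W) (hfw : f w = 0) : ∃ b : K, w = b • x := by
  have hli : LinearIndependent K ![x, u] := by
    refine (LinearIndependent.pair_iff' hx0).mpr fun a ha => hfu ?_
    rw [← ha, map_smul, hfx, smul_zero]
  obtain ⟨a, b, rfl⟩ := exists_eq_smul_add_smul_of_finrank_eq_two hW hx hu hli hw
  have hb : b = 0 := by simpa [hfx, hfu] using hfw
  exact ⟨a, by rw [hb, zero_smul, add_zero]⟩

end Submodule

/-! ### Skew lines and their transversals -/

namespace QuadrilinearForm

open Polynomial

variable {B : QuadrilinearForm} {V W : Submodule ℂ C4}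

/-- `V` and `W` are skew lines on the smooth quartic surface `B v v v v = 0`. -/
structure IsSkewLinePair (B : QuadrilinearForm) (V W : Submodule ℂ C4) : Prop where
  isSymm : B.IsSymm
  finrank_left : Module.finrank ℂ V = 2
  finrank_right : Module.finrank ℂ W = 2
  isCompl : IsCompl V W
  left_zero : ∀ v ∈ V, B v v v v = 0
  right_zero : ∀ v ∈ W, B v v v v = 0
  smooth : ∀ v, v ≠ 0 → B v v v v = 0 → ∃ w, B w v v v ≠ 0

theorem IsSkewLinePair.symm (h : B.IsSkewLinePair V W) : B.IsSkewLinePair W V :=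
  ⟨h.isSymm, h.finrank_right, h.finrank_left, h.isCompl.symm, h.right_zero, h.left_zero, h.smooth⟩

/-- The surface contains `W`, so its derivative at `y` vanishes along `W`; a direction of nonzero
derivative can be taken in `V`. -/
theorem IsSkewLinePair.exists_ne_zero (h : B.IsSkewLinePair V W) {y : C4} (hy : y ∈ W)
    (hy0 : y ≠ 0) : ∃ x ∈ V, B x y y y ≠ 0 := by
  obtain ⟨w, hw⟩ := h.smooth y hy0 (h.right_zero y hy)
  obtain ⟨x, hx, y', hy', rfl⟩ := Submodule.mem_sup.mp
    (h.isCompl.sup_eq_top ▸ Submodule.mem_top : w ∈ V ⊔ W)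
  refine ⟨x, hx, ?_⟩
  have hz : B y' y y y = 0 := (h.isSymm.mixed_eq_zero (x := y') (y := y)
    (fun a => h.right_zero _ (W.add_mem (W.smul_mem a hy') hy)) (h.right_zero _ hy')).2.2
  rwa [map_add, LinearMap.add_apply, LinearMap.add_apply, LinearMap.add_apply, hz, add_zero] at hw

/-- The restriction of the cubic form `B x y y y` to the affine line `y = v + t w`. -/
noncomputable def cubicPoly (B : QuadrilinearForm) (x v w : C4) : ℂ[X] :=
  C (B x w w w) * X ^ 3 + C (3 * B x v w w) * X ^ 2 + C (3 * B x v v w) * X + C (B x v v v)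

/-- The restriction of the quadratic form `B x x' y y` to the affine line `y = v + t w`. -/
noncomputable def quadraticPoly (B : QuadrilinearForm) (x x' v w : C4) : ℂ[X] :=
  C (B x x' w w) * X ^ 2 + C (2 * B x x' v w) * X + C (B x x' v v)

theorem IsSymm.eval_cubicPoly (hB : B.IsSymm) (x v w : C4) (t : ℂ) :
    (cubicPoly B x v w).eval t = B x (v + t • w) (v + t • w) (v + t • w) := by
  simp only [cubicPoly, eval_add, eval_mul, eval_C, eval_pow, eval_X, map_add, map_smul,
    LinearMap.add_apply, LinearMap.smul_apply, smul_eq_mul]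
  simp only [hB.swap_middle _ w v, hB.swap_last _ _ w v]
  ring

theorem IsSymm.eval_quadraticPoly (hB : B.IsSymm) (x x' v w : C4) (t : ℂ) :
    (quadraticPoly B x x' v w).eval t = B x x' (v + t • w) (v + t • w) := by
  simp only [quadraticPoly, eval_add, eval_mul, eval_C, eval_pow, eval_X, map_add, map_smul,
    LinearMap.add_apply, LinearMap.smul_apply, smul_eq_mul]
  simp only [hB.swap_last _ _ w v]
  ring

/-- A binary cubic form over `ℂ` has a nontrivial zero. -/
theorem IsSymm.exists_cubic_zero (hB : B.IsSymm) (hW : Module.finrank ℂ W = 2) (x : C4) :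
    ∃ y ∈ W, y ≠ 0 ∧ B x y y y = 0 := by
  obtain ⟨w, hw, hw0⟩ := W.exists_mem_ne_zero_of_ne_bot (by
    rintro rfl
    simp at hW)
  obtain ⟨v, hv, hli⟩ := Submodule.exists_linearIndependent_of_finrank_eq_two hW hw0
  by_cases hx : B x w w w = 0
  · exact ⟨w, hw, hw0, hx⟩
  obtain ⟨t, ht⟩ := IsAlgClosed.exists_root (cubicPoly B x v w) (by
    rw [cubicPoly, degree_cubic hx]
    decide)
  refine ⟨v + t • w, W.add_mem hv (W.smul_mem t hw), fun h0 => ?_, ?_⟩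
  · have := LinearIndependent.pair_iff.mp hli t 1 (by rw [one_smul, add_comm, h0])
    exact one_ne_zero this.2
  · rw [← hB.eval_cubicPoly]
    exact ht

/-- The line `m` of the surface `B v v v v = 0` meets both `V` and `W`. -/
structure IsTransversal (B : QuadrilinearForm) (V W m : Submodule ℂ C4) : Prop where
  finrank_eq : Module.finrank ℂ m = 2
  zero : ∀ v ∈ m, B v v v v = 0
  exists_left : ∃ x ∈ V, x ≠ 0 ∧ x ∈ m
  exists_right : ∃ y ∈ W, y ≠ 0 ∧ y ∈ m

theorem IsTransversal.mixed_eq_zero {m : Submodule ℂ C4} (hm : B.IsTransversal V W m)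
    (hB : B.IsSymm) {x y : C4} (hx : x ∈ m) (hy : y ∈ m) :
    B x x y y = 0 ∧ B x y y y = 0 :=
  (hB.mixed_eq_zero (fun a => hm.zero _ (m.add_mem (m.smul_mem a hx) hy)) (hm.zero _ hx)).2

/-- A transversal is determined by its point on `W`. -/
theorem IsSkewLinePair.transversal_eq (h : B.IsSkewLinePair V W) {m m' : Submodule ℂ C4}
    (hm : B.IsTransversal V W m) (hm' : B.IsTransversal V W m') {y : C4} (hy : y ∈ W)
    (hy0 : y ≠ 0) (hym : y ∈ m) (hym' : y ∈ m') : m = m' := by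
  have : FiniteDimensional ℂ m' := Module.finite_of_finrank_eq_succ hm'.finrank_eq
  obtain ⟨x, hx, hx0, hxm⟩ := hm.exists_left
  obtain ⟨x', hx', hx0', hxm'⟩ := hm'.exists_left
  -- The form `x ↦ B x y y y` is nonzero on `V`, so both transversals pass through its only zero
  -- there.
  obtain ⟨u, hu, hu0⟩ := h.exists_ne_zero hy hy0
  obtain ⟨b, rfl⟩ := Submodule.exists_eq_smul_of_apply_eq_zero h.finrank_left
    (((B.flip y).flip y).flip y) hu hu0 hx' hx0' (hm'.mixed_eq_zero h.isSymm hxm' hym').2 hx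
    (hm.mixed_eq_zero h.isSymm hxm hym).2
  have hli : LinearIndependent ℂ ![b • x', y] := by
    refine (LinearIndependent.pair_iff' hx0).mpr fun a ha => hy0 ?_
    exact Submodule.disjoint_def.mp h.isCompl.disjoint y (ha ▸ V.smul_mem a hx) hy
  refine Submodule.eq_of_le_of_finrank_eq (fun w hw => ?_)
    (hm.finrank_eq.trans hm'.finrank_eq.symm)
  obtain ⟨c, d, rfl⟩ := Submodule.exists_eq_smul_add_smul_of_finrank_eq_two hm.finrank_eq hxm hym
    hli hw
  exact m'.add_mem (m'.smul_mem c (m'.smul_mem b hxm')) (m'.smul_mem d hym')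

end QuadrilinearForm

/-- If `A` and `P` are coprime and `a`, `b`, `c` have smaller degree than `A`, then
`P² a - 2 A P b + A² c` vanishes only for `a = b = c = 0`. -/
theorem Polynomial.eq_zero_of_isCoprime_of_combination_eq_zero {K : Type*} [Field K] [CharZero K]
    {A P a b c : Polynomial K} (hAP : IsCoprime A P) (ha : a.natDegree < A.natDegree)
    (hb : b.natDegree < A.natDegree) (h : P ^ 2 * a - 2 * A * P * b + A ^ 2 * c = 0) :
    a = 0 ∧ b = 0 ∧ c = 0 := by
  have hA : A ≠ 0 := by
    rintro rfl
    simp at ha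
  -- Modulo `A` only `P ^ 2 * a` remains, so `A` divides `a`. After cancelling one `A`, the same
  -- argument applies to `2 * b`.
  have ha0 : a = 0 := by
    refine Polynomial.eq_zero_of_dvd_of_natDegree_lt
      ((hAP.pow_right (n := 2)).dvd_of_dvd_mul_left ⟨2 * P * b - A * c, ?_⟩) ha
    linear_combination h
  subst ha0
  have h1 : P * (2 * b) = A * c := by
    refine mul_left_cancel₀ hA ?_
    linear_combination -h
  have hb0 : 2 * b = 0 := by
    refine Polynomial.eq_zero_of_dvd_of_natDegree_lt (hAP.dvd_of_dvd_mul_left ⟨c, h1⟩) ?_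
    rwa [← Polynomial.C_ofNat, Polynomial.natDegree_C_mul two_ne_zero]
  rw [hb0, mul_zero, eq_comm, mul_eq_zero, or_iff_right hA] at h1
  exact ⟨rfl, (mul_eq_zero.mp hb0).resolve_left two_ne_zero, h1⟩

/-! ### Vanishing of the part of bidegree `(2, 2)` -/

namespace QuadrilinearForm

open Polynomial

variable {B : QuadrilinearForm} {V W : Submodule ℂ C4}

theorem natDegree_quadraticPoly_le (x x' v w : C4) : (quadraticPoly B x x' v w).natDegree ≤ 2 :=
  natDegree_quadratic_le

theorem natDegree_cubicPoly_le (x v w : C4) : (cubicPoly B x v w).natDegree ≤ 3 :=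
  natDegree_cubic_le

theorem apply_eq_zero_of_quadraticPoly_eq_zero {x x' v w : C4}
    (h : quadraticPoly B x x' v w = 0) :
    B x x' v v = 0 ∧ B x x' v w = 0 ∧ B x x' w w = 0 := by
  have h0 := congrArg (coeff · 0) h
  have h1 := congrArg (coeff · 1) h
  have h2 := congrArg (coeff · 2) h
  simp [quadraticPoly, coeff_X, coeff_C] at h0 h1 h2
  exact ⟨h0, h1, h2⟩

/-- If two skew lines on a smooth quartic have at least ten common transversals on it, then the
part of bidegree `(2, 2)` of its equation vanishes. -/
theorem IsSkewLinePair.apply_eq_zero_of_transversals (h : B.IsSkewLinePair V W)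
    (S : Finset (Submodule ℂ C4)) (hS : 10 ≤ S.card) (hT : ∀ m ∈ S, B.IsTransversal V W m)
    {x y : C4} (hx : x ∈ V) (hy : y ∈ W) : B x x y y = 0 := by
  classical
  have hsymm := h.isSymm
  obtain ⟨w, hw, hw0⟩ := W.exists_mem_ne_zero_of_ne_bot (by
    rintro rfl
    simpa using h.finrank_right)
  obtain ⟨v, hv, hvw⟩ := Submodule.exists_linearIndependent_of_finrank_eq_two h.finrank_right hw0
  -- This choice of `u` makes the degree of `A` exactly 3, above the degrees of `a`, `b`, `c`.
  obtain ⟨u, hu, hu3⟩ := h.exists_ne_zero hw hw0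
  have hu0 : u ≠ 0 := by
    rintro rfl
    simp at hu3
  obtain ⟨u', hu', huu⟩ := Submodule.exists_linearIndependent_of_finrank_eq_two h.finrank_left hu0
  have hpt (t : ℂ) : v + t • w ∈ W := W.add_mem hv (W.smul_mem t hw)
  have hpt0 (t : ℂ) : v + t • w ≠ 0 := fun h0 =>
    one_ne_zero (LinearIndependent.pair_iff.mp hvw t 1 (by rw [one_smul, add_comm, h0])).2
  set A := cubicPoly B u v w with hA
  set P := cubicPoly B u' v w with hP
  set a := quadraticPoly B u u v w with ha
  set b := quadraticPoly B u u' v w with hb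
  set c := quadraticPoly B u' u' v w with hc
  have hAdeg : A.natDegree = 3 := natDegree_cubic hu3
  have hPdeg : P.natDegree ≤ 3 := natDegree_cubicPoly_le _ _ _
  have hadeg : a.natDegree ≤ 2 := natDegree_quadraticPoly_le _ _ _ _
  have hbdeg : b.natDegree ≤ 2 := natDegree_quadraticPoly_le _ _ _ _
  have hcdeg : c.natDegree ≤ 2 := natDegree_quadraticPoly_le _ _ _ _
  -- At a common root `t`, all of `V` would be killed by `x ↦ B x y y y` with `y = v + t • w`,
  -- against smoothness.
  have hAP : IsCoprime A P := by
    refine (isCoprime_iff_aeval_ne_zero_of_isAlgClosed ℂ ℂ _ _).mpr fun t => ?_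
    by_contra! H
    simp only [coe_aeval_eq_eval, hA, hP, hsymm.eval_cubicPoly] at H
    obtain ⟨z, hz, hz3⟩ := h.exists_ne_zero (hpt t) (hpt0 t)
    obtain ⟨α, β, rfl⟩ :=
      Submodule.exists_eq_smul_add_smul_of_finrank_eq_two h.finrank_left hu hu' huu hz
    generalize v + t • w = p at H hz3
    simp [H.1, H.2] at hz3
  -- This is `B x x y y` at `x = P u - A u'`, the zero of `x ↦ B x y y y` on `V`.
  set R := P ^ 2 * a - 2 * A * P * b + A ^ 2 * c with hR
  have hReval (t : ℂ) (m : Submodule ℂ C4) (hm : B.IsTransversal V W m) (htm : v + t • w ∈ m) :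
      R.eval t = 0 := by
    obtain ⟨z, hz, hz0, hzm⟩ := hm.exists_left
    obtain ⟨q, hq, hq3⟩ := h.exists_ne_zero (hpt t) (hpt0 t)
    obtain ⟨k, hk⟩ := Submodule.exists_eq_smul_of_apply_eq_zero h.finrank_left
      (((B.flip (v + t • w)).flip (v + t • w)).flip (v + t • w)) hq hq3 hz hz0
      (hm.mixed_eq_zero hsymm hzm htm).2
      (V.sub_mem (V.smul_mem (P.eval t) hu) (V.smul_mem (A.eval t) hu')) (by
        simp only [hA, hP, hsymm.eval_cubicPoly, LinearMap.flip_apply, map_sub, map_smul,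
          smul_eq_mul]
        ring)
    have h2 : B (k • z) (k • z) (v + t • w) (v + t • w) = 0 := by
      simp only [map_smul, LinearMap.smul_apply, (hm.mixed_eq_zero hsymm hzm htm).1, smul_zero]
    rw [← hk] at h2
    generalize hp : v + t • w = p at h2
    simp only [map_sub, map_smul, LinearMap.sub_apply, LinearMap.smul_apply, smul_eq_mul,
      hsymm.swap_first u' u] at h2
    simp only [hR, eval_add, eval_sub, eval_mul, eval_pow, ha, hb, hc, hsymm.eval_quadraticPoly,
      eval_ofNat, hp]
    linear_combination h2
  have hRdeg : R.natDegree < 9 := by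
    refine Nat.lt_succ_of_le ?_
    rw [hR]
    have hAP' : (2 * A * P).natDegree ≤ 6 := by
      rw [mul_assoc, ← C_ofNat]
      exact (natDegree_C_mul_le _ _).trans (natDegree_mul_le_of_le hAdeg.le hPdeg)
    refine natDegree_add_le_of_degree_le
      ((natDegree_sub_le_of_le (m := 8) (n := 8) ?_ ?_).trans (max_self 8).le) ?_
    · exact natDegree_mul_le_of_le (m := 6) (n := 2) (natDegree_pow_le_of_le 2 hPdeg) hadeg
    · exact natDegree_mul_le_of_le (m := 6) (n := 2) hAP' hbdeg
    · exact natDegree_mul_le_of_le (m := 6) (n := 2) (natDegree_pow_le_of_le 2 hAdeg.le) hcdeg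
  have hR0 : R = 0 := by
    -- The chart `v + t • w` misses only the point `w`, which lies on at most one transversal; nine
    -- roots remain, against degree at most 8.
    have hcard : 9 ≤ (S.filter (w ∉ ·)).card := by
      have h1 : (S.filter (w ∈ ·)).card ≤ 1 := Finset.card_le_one.mpr fun m hm m' hm' => by
        rw [Finset.mem_filter] at hm hm'
        exact h.transversal_eq (hT m hm.1) (hT m' hm'.1) hw hw0 hm.2 hm'.2
      have h2 := Finset.card_filter_add_card_filter_not (s := S) (w ∈ ·)
      omega
    have hex (m : (S.filter (w ∉ ·))) : ∃ t : ℂ, v + t • w ∈ m.1 := by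
      obtain ⟨hmS, hwm⟩ := Finset.mem_filter.mp m.2
      obtain ⟨z, hz, hz0, hzm⟩ := (hT m.1 hmS).exists_right
      obtain ⟨α, β, rfl⟩ :=
        Submodule.exists_eq_smul_add_smul_of_finrank_eq_two h.finrank_right hw hv hvw hz
      have hβ : β ≠ 0 := by
        rintro rfl
        rw [zero_smul, add_zero] at hz0 hzm
        exact hwm ((m.1.smul_mem_iff (fun h0 => hz0 (by rw [h0, zero_smul]))).mp hzm)
      refine ⟨β⁻¹ * α, ?_⟩
      have := m.1.smul_mem β⁻¹ hzm
      rwa [smul_add, smul_smul, smul_smul, inv_mul_cancel₀ hβ, one_smul, add_comm] at this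
    choose f hf using hex
    have hTm (m : (S.filter (w ∉ ·))) := hT m.1 (Finset.mem_filter.mp m.2).1
    refine eq_zero_of_natDegree_lt_card_of_eval_eq_zero R (f := f) (fun m m' hmm => ?_)
      (fun m => hReval _ m.1 (hTm m) (hf m)) ?_
    · exact Subtype.ext (h.transversal_eq (hTm m) (hTm m') (hpt _) (hpt0 _) (hf m) (hmm ▸ hf m'))
    · rw [Fintype.card_coe]
      omega
  obtain ⟨ha0, hb0, hc0⟩ := eq_zero_of_isCoprime_of_combination_eq_zero hAP
    (by omega) (by omega) hR0
  obtain ⟨a1, a2, a3⟩ := apply_eq_zero_of_quadraticPoly_eq_zero ha0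
  obtain ⟨b1, b2, b3⟩ := apply_eq_zero_of_quadraticPoly_eq_zero hb0
  obtain ⟨c1, c2, c3⟩ := apply_eq_zero_of_quadraticPoly_eq_zero hc0
  obtain ⟨α, β, rfl⟩ :=
    Submodule.exists_eq_smul_add_smul_of_finrank_eq_two h.finrank_left hu hu' huu hx
  obtain ⟨γ, δ, rfl⟩ :=
    Submodule.exists_eq_smul_add_smul_of_finrank_eq_two h.finrank_right hw hv hvw hy
  simp only [map_add, map_smul, LinearMap.add_apply, LinearMap.smul_apply, smul_eq_mul,
    hsymm.swap_first u' u, hsymm.swap_last _ _ w v, a1, a2, a3, b1, b2, b3, c1, c2, c3]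
  ring

/-- A product of three linear forms matching `B p y y y + s² B p p p y` along the planes through
`W`: the form of the residual cubic when the part of bidegree `(2, 2)` vanishes. -/
theorem residual_identities {b₁ b₃ k α β f₁ f₂ f₃ : ℂ} (hk : k ≠ 0)
    (h : ∀ s : ℂ, s * b₁ + s ^ 3 * b₃ = k * s * f₁ * (f₂ + s * α) * (f₃ + s * β)) :
    b₁ = k * f₁ * f₂ * f₃ ∧ b₃ = k * f₁ * α * β ∧ f₁ * (α * f₃ + β * f₂) = 0 := by
  -- Both sides are cubics in `s` without constant term, so three nonzero values determine the
  -- coefficients.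
  have h1 := h 1
  have h2 := h (-1)
  have h3 := h 2
  have h4 : b₃ = k * f₁ * α * β := by
    linear_combination (-1 / 2) * h1 - h2 / 6 + h3 / 6
  refine ⟨?_, h4, mul_left_cancel₀ hk ?_⟩
  · linear_combination (h1 - h2) / 2 - h4
  · linear_combination -(h1 + h2) / 2

/-- If a product of two linear forms vanishes on a subspace, so does one of them. -/
theorem _root_.LinearMap.eq_zero_on_of_mul_eq_zero {K M : Type*} [Field K] [AddCommGroup M]
    [Module K M] {U : Submodule K M} (f g : M →ₗ[K] K) (h : ∀ y ∈ U, f y * g y = 0) {y₁ : M}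
    (hy₁ : y₁ ∈ U) (hf : f y₁ ≠ 0) {y : M} (hy : y ∈ U) : g y = 0 := by
  by_contra hg
  have hg₁ : g y₁ = 0 := (mul_eq_zero.mp (h y₁ hy₁)).resolve_left hf
  have hfy : f y = 0 := (mul_eq_zero.mp (h y hy)).resolve_right hg
  have := h _ (U.add_mem hy hy₁)
  rw [map_add, map_add, hg₁, hfy, zero_add, add_zero] at this
  exact mul_ne_zero hf hg this

end QuadrilinearForm

/-! ### Twin lines and the residual cubic -/

theorem Meets.exists_mem {l m : Submodule ℂ C4} (h : Meets l m) :
    ∃ x ∈ m, x ≠ 0 ∧ x ∈ l := by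
  obtain ⟨P, hl, hm⟩ := h
  have hP : P.rep ∈ P.submodule := by
    rw [P.submodule_eq]
    exact Submodule.mem_span_singleton_self _
  exact ⟨P.rep, hm hP, P.rep_nonzero, hl hP⟩

theorem disjoint_of_not_meets {l m : Submodule ℂ C4} (h : ¬ Meets l m) : Disjoint l m := by
  refine Submodule.disjoint_def.mpr fun x hl hm => ?_
  by_contra hx
  refine h ⟨Projectivization.mk ℂ x hx, ?_, ?_⟩ <;>
    rwa [Projectivization.submodule_mk, Submodule.span_singleton_le_iff_mem]

/-- The order is reversed so that the line whose residual cubic is studied plays the role of `W`. -/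
theorem AreTwinLines.isSkewLinePair {F : MvPolynomial (Fin 4) ℂ} (hF : IsSmoothQuartic F)
    {l l' : Submodule ℂ C4} (h : AreTwinLines F l l') :
    (MvPolynomial.polarization F).IsSkewLinePair l' l := by
  obtain ⟨⟨hl, hl0⟩, ⟨hl', hl0'⟩, hmeet, -⟩ := h
  have hdisj : Disjoint l' l := (disjoint_of_not_meets hmeet).symm
  refine ⟨F.polarization_isSymm, hl', hl, ?_, fun v hv => ?_, fun v hv => ?_,
    fun v hv => hF.exists_polarization_ne_zero hv⟩
  · refine (Submodule.isCompl_iff_disjoint l' l ?_).mpr hdisj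
    rw [show Module.finrank ℂ l = 2 from hl, show Module.finrank ℂ l' = 2 from hl']
    simp
  · rw [hF.1.polarization_self, hl0' v hv, mul_zero]
  · rw [hF.1.polarization_self, hl0 v hv, mul_zero]

theorem AreTwinLines.polarization_eq_zero {F : MvPolynomial (Fin 4) ℂ} (hF : IsSmoothQuartic F)
    {l l' : Submodule ℂ C4} (h : AreTwinLines F l l') {x y : C4} (hx : x ∈ l') (hy : y ∈ l) :
    MvPolynomial.polarization F x x y y = 0 := by
  obtain ⟨S, hS, hm⟩ := h.2.2.2
  refine (h.isSkewLinePair hF).apply_eq_zero_of_transversals S hS.ge (fun m hmS => ?_) hx hy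
  obtain ⟨⟨hfin, h0⟩, -, -, hl, hl'⟩ := hm m hmS
  refine ⟨hfin, fun v hv => ?_, hl'.exists_mem, hl.exists_mem⟩
  rw [hF.1.polarization_self, h0 v hv, mul_zero]

/-- A plane is spanned by a line in it and a point of it outside that line. -/
theorem IsProjPlane.exists_eq_smul_add {E l : Submodule ℂ C4} (hE : IsProjPlane E)
    (hl : IsProjLine l) (hlE : l ≤ E) {p : C4} (hp : p ∈ E) (hpl : p ∉ l) {v : C4} (hv : v ∈ E) :
    ∃ s : ℂ, ∃ y ∈ l, v = s • p + y := by
  have hle : (ℂ ∙ p) ⊔ l ≤ E := sup_le ((Submodule.span_singleton_le_iff_mem p E).mpr hp) hlE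
  have hlt : l < (ℂ ∙ p) ⊔ l := lt_of_le_of_ne le_sup_right fun h =>
    hpl (h ▸ Submodule.mem_sup_left (Submodule.mem_span_singleton_self p))
  have hfin := Submodule.finrank_lt_finrank_of_lt hlt
  have heq : (ℂ ∙ p) ⊔ l = E := Submodule.eq_of_le_of_finrank_le hle (by
    unfold IsProjPlane at hE
    unfold IsProjLine at hl
    omega)
  rw [← heq] at hv
  obtain ⟨z, hz, y, hy, rfl⟩ := Submodule.mem_sup.mp hv
  obtain ⟨s, rfl⟩ := Submodule.mem_span_singleton.mp hz
  exact ⟨s, y, hy, rfl⟩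

theorem mainTheorem9 (F : MvPolynomial (Fin 4) ℂ) (hF : IsSmoothQuartic F)
    (l' l'' : Submodule ℂ C4) (htwin : AreTwinLines F l' l'')
    (E : Submodule ℂ C4) (hE : IsProjPlane E) (hlE : l' ≤ E)
    (G : MvPolynomial (Fin 4) ℂ) (hG : IsResidualCubic F l' E G)
    (m₁ m₂ m₃ : Submodule ℂ C4) (hsplit : SplitsIntoLines E G m₁ m₂ m₃)
    (hmeet : Meets m₁ l'') :
    ∃ P : ℙ ℂ C4, m₂ ⊓ m₃ = P.submodule ∧ P.submodule ≤ l' := by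
  have hpair := htwin.isSkewLinePair hF
  obtain ⟨-, φ, hφ, hFG⟩ := hG
  obtain ⟨-, -, -, φ₁, φ₂, φ₃, hφ₁, hφ₂, hφ₃, hGφ⟩ := hsplit
  simp only [IsEquationIn] at hφ hφ₁ hφ₂ hφ₃
  obtain ⟨p, hp, hp0, hpm⟩ := hmeet.exists_mem
  rw [← hφ₁] at hpm
  obtain ⟨hpE, hp₁ : φ₁ p = 0⟩ := hpm
  have hpl : p ∉ l' := fun h => hp0 (Submodule.disjoint_def.mp hpair.isCompl.disjoint p hp h)
  have hφp : φ p ≠ 0 := fun h => hpl (hφ ▸ ⟨hpE, h⟩)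
  have hφl : ∀ y ∈ l', φ y = 0 := fun y hy => by
    rw [← hφ] at hy
    exact hy.2
  set B := MvPolynomial.polarization F with hB
  have key : ∀ y ∈ l', B p y y y = 6 * φ p * φ₁ y * φ₂ y * φ₃ y ∧
      B p p p y = 6 * φ p * φ₁ y * φ₂ p * φ₃ p ∧
      φ₁ y * (φ₂ p * φ₃ y + φ₃ p * φ₂ y) = 0 := fun y hy => by
    refine QuadrilinearForm.residual_identities (mul_ne_zero (by norm_num) hφp) fun s => ?_
    have hvE : s • p + y ∈ E := E.add_mem (E.smul_mem s hpE) (hlE hy)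
    have h1 := hpair.isSymm.apply_add_smul p y s 1
    rw [one_smul, hB, hF.1.polarization_self, hFG _ hvE, hGφ _ hvE, ← hB,
      htwin.polarization_eq_zero hF hp hy, hpair.left_zero p hp, hpair.right_zero y hy] at h1
    simp only [map_add, map_smul, smul_eq_mul, hφl y hy, hp₁] at h1
    -- The 24 of the polarization against the binomial coefficient 4 gives the constant 6.
    linear_combination -h1 / 4
  -- Smoothness at `p` gives `φ₂ p ≠ 0` and `φ₃ p ≠ 0`, and shows that `φ₁` is not identically zero
  -- on `l'`.
  obtain ⟨y₁, hy₁, hB₁⟩ := hpair.symm.exists_ne_zero hp hp0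
  rw [← hpair.isSymm.reverse, (key y₁ hy₁).2.1] at hB₁
  simp only [ne_eq, mul_eq_zero, not_or] at hB₁
  obtain ⟨⟨⟨-, hφ₁y⟩, hα⟩, hβ⟩ := hB₁
  have hrel : ∀ y ∈ l', φ₂ p * φ₃ y + φ₃ p * φ₂ y = 0 := fun y hy =>
    LinearMap.eq_zero_on_of_mul_eq_zero φ₁ (φ₂ p • φ₃ + φ₃ p • φ₂)
      (fun z hz => (key z hz).2.2) hy₁ hφ₁y hy
  obtain ⟨u, hu, hφu⟩ : ∃ u ∈ l', φ₂ u ≠ 0 := by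
    -- Otherwise `B p y y y = 0` on all of `l'`, and a zero `y` of `B p' y y y` would be a singular
    -- point.
    by_contra! H
    obtain ⟨p', hp', hpp⟩ :=
      Submodule.exists_linearIndependent_of_finrank_eq_two hpair.finrank_left hp0
    obtain ⟨y, hy, hy0, hy3⟩ := hpair.isSymm.exists_cubic_zero hpair.finrank_right p'
    obtain ⟨x, hx, hxy⟩ := hpair.exists_ne_zero hy hy0
    obtain ⟨a, b, rfl⟩ := Submodule.exists_eq_smul_add_smul_of_finrank_eq_two hpair.finrank_left
      hp hp' hpp hx
    have hpy : B p y y y = 0 := by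
      rw [(key y hy).1, H y hy, mul_zero, zero_mul]
    simp [hpy, hy3] at hxy
  obtain ⟨y₀, hy₀, hy₀0, hφy₀⟩ : ∃ y ∈ l', y ≠ 0 ∧ φ₂ y = 0 := by
    obtain ⟨w, hw, hli⟩ := Submodule.exists_linearIndependent_of_finrank_eq_two
      hpair.finrank_right (u := u) (by rintro rfl; simp at hφu)
    refine ⟨(-φ₂ w) • u + φ₂ u • w, l'.add_mem (l'.smul_mem _ hu) (l'.smul_mem _ hw),
      fun h0 => hφu (LinearIndependent.pair_iff.mp hli _ _ h0).2, ?_⟩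
    simp only [map_add, map_smul, smul_eq_mul]
    ring
  have hφ₃y₀ : φ₃ y₀ = 0 := by
    have := hrel y₀ hy₀
    rw [hφy₀, mul_zero, add_zero] at this
    exact (mul_eq_zero.mp this).resolve_left hα
  refine ⟨Projectivization.mk ℂ y₀ hy₀0, ?_, ?_⟩
  · rw [Projectivization.submodule_mk]
    refine le_antisymm (fun v hv => ?_) ?_
    · rw [← hφ₂, ← hφ₃] at hv
      obtain ⟨⟨hvE, hv₂ : φ₂ v = 0⟩, -, hv₃ : φ₃ v = 0⟩ := hv
      obtain ⟨s, y, hy, rfl⟩ := hE.exists_eq_smul_add htwin.1.1 hlE hpE hpl hvE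
      simp only [map_add, map_smul, smul_eq_mul] at hv₂ hv₃
      have hs : s = 0 := by
        -- The evenness relation `hrel` cancels the contributions of `y`.
        have : (2 * (φ₂ p * φ₃ p)) * s = 0 := by
          linear_combination φ₃ p * hv₂ + φ₂ p * hv₃ - hrel y hy
        exact (mul_eq_zero.mp this).resolve_left
          (mul_ne_zero two_ne_zero (mul_ne_zero hα hβ))
      subst hs
      rw [zero_mul, zero_add] at hv₂
      obtain ⟨b, rfl⟩ := Submodule.exists_eq_smul_of_apply_eq_zero hpair.finrank_right φ₂ hu hφu
        hy₀ hy₀0 hφy₀ hy hv₂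
      rw [zero_smul, zero_add]
      exact Submodule.smul_mem _ _ (Submodule.mem_span_singleton_self _)
    · rw [Submodule.span_singleton_le_iff_mem, ← hφ₂, ← hφ₃]
      exact ⟨⟨hlE hy₀, hφy₀⟩, hlE hy₀, hφ₃y₀⟩
  · rwa [Projectivization.submodule_mk, Submodule.span_singleton_le_iff_mem]
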